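/- **Theorem.** Let $N$ be a finite set with $n$ elements, let $k\in\mathbb N$, and let $L=\{0,\dots,k\}^N$. Let $v:L\to\mathbb R$ be a $k$-ary capacity, that is, $v(0,\dots,0)=0$, $v(k,\dots,k)=1$ and $v(x)\le v(y)$ whenever $x\le y$. For $z\in[0,k]^N$ with integer part $q=\lfloor z\rfloor$ let $$\mathcal C_v(z)=v(q)+C_{\mu_q}(z-q),\qquad \mu_q(A)=v\big((q+1)_A,q_{-A}\big)-v(q)\quad(A\subseteq N),$$ where $C_\mu(w)=\int_0^\infty \mu(\{i: w_i\ge t\})\,dt$ is the Choquet integral (a coordinate of $q$ equal to $k$ is not increased in $\mu_q$; this does not affect the value). For $T\subseteq N$ with $|T|=t$ let $$I^v_{\mathrm s}(T)=\sum_{x_{-T}\in\{0,\dots,k\}^{N\setminus T}}\frac{(n-s(x_{-T})-t)!\,k(x_{-T})!}{(n-s(x_{-T})+k(x_{-T})-t+1)!}\sum_{A\subseteq T}(-1)^{t-|A|}\,v(0_{T\setminus A},k_A,x_{-T}),$$ where $s(x_{-T})$ and $k(x_{-T})$ are the numbers of coordinates of $x_{-T}$ that are $\neq 0$ and $=k$,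 respectively. Then $\mathcal C_v$ is integrable on $[0,k]^N$ and, for every $T\subseteq N$, $$I^v_{\mathrm s}(T)=\int_{[0,k]^n}\frac{\partial^{|T|}\mathcal C_v}{\partial z_T}(z)\,dz ,$$ where $\partial^{|T|}/\partial z_T$ is one partial derivative with respect to each $z_i$, $i\in T$, taken in the sense of distributions in the interior of the box: the distribution $\partial^{|T|}\mathcal C_v/\partial z_T$ on $(0,k)^N$ is given by a finite signed measure, and every such measure has total mass $I^v_{\mathrm s}(T)$ on $(0,k)^N$. Moreover, when $T=\{i\}$, the ordinary partial derivative $\partial\mathcal C_v/\partial z_i$ exists almost everywhere on $[0,k]^N$, is integrable, and the formula holds with it as a Lebesgue integral. -/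

import Mathlib

open MeasureTheory TopologicalSpace
open scoped Distributions LineDeriv Nat

noncomputable section

namespace KAry

/-- A `k`-ary capacity on the attribute set `N`: a function on `L = {0, …, k}^N` that vanishes at
`(0, …, 0)`, is monotone, and takes the value `1` at `(k, …, k)`. -/
structure IsCapacity {N : Type*} {k : ℕ} (v : (N → Fin (k + 1)) → ℝ) : Prop where
  zero : v (fun _ => 0) = 0
  mono : Monotone v
  top : v (fun _ => Fin.last k) = 1

section Index

variable {N : Type*} [Fintype N] [DecidableEq N] {k : ℕ}

/-- The point `(0_{T \ A}, k_A, x_{-T})` of `L`. -/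
def compound (T A : Finset N) (x : {i : N // i ∉ T} → Fin (k + 1)) : N → Fin (k + 1) :=
  fun i => if h : i ∈ T then (if i ∈ A then Fin.last k else 0) else x ⟨i, h⟩

/-- `s(x_{-T})`: the number of coordinates of `x_{-T}` that are different from `0`. -/
def suppCard (T : Finset N) (x : {i : N // i ∉ T} → Fin (k + 1)) : ℕ :=
  (Finset.univ.filter fun i => x i ≠ 0).card

/-- `k(x_{-T})`: the number of coordinates of `x_{-T}` that are equal to `k`. -/
def kerCard (T : Finset N) (x : {i : N // i ∉ T} → Fin (k + 1)) : ℕ :=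
  (Finset.univ.filter fun i => x i = Fin.last k).card

/-- The interaction index `I_s^v(T)`. As `s(x_{-T}) ≤ n - t`, no subtraction is truncated. -/
def interaction (v : (N → Fin (k + 1)) → ℝ) (T : Finset N) : ℝ :=
  ∑ x : {i : N // i ∉ T} → Fin (k + 1),
    (((Fintype.card N - suppCard T x - T.card)! * (kerCard T x)! : ℕ) : ℝ) /
        (((Fintype.card N - suppCard T x + kerCard T x - T.card + 1)! : ℕ) : ℝ) *
      ∑ A ∈ T.powerset, (-1 : ℝ) ^ (T.card - A.card) * v (compound T A x)

/-- The Choquet integral `∫_0^∞ μ({i | w_i ≥ t}) dt` of a nonnegative vector `w` with respect to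
a set function `μ` with `μ(∅) = 0`. -/
def choquetIntegral (μ : Finset N → ℝ) (w : N → ℝ) : ℝ :=
  ∫ t in Set.Ioi (0 : ℝ), μ (Finset.univ.filter fun i => t ≤ w i)

end Index

section Choquet

variable {N : Type*} {k : ℕ}

/-- The element `min m k` of `{0, …, k}`. -/
def level (k m : ℕ) : Fin (k + 1) := ⟨min m k, by omega⟩

/-- The integer part `⌊z⌋ ∈ L` of a point `z ∈ [0,k]^N`. -/
def gridFloor (k : ℕ) (z : N → ℝ) : N → Fin (k + 1) := fun i => level k ⌊z i⌋₊

/-- `μ_q(A) = v((q+1)_A, q_{-A}) - v(q)`. A coordinate that is already equal to `k` is left at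
`k`; for `q = ⌊z⌋` such a coordinate has `z_i - q_i = 0`, so that this convention has no influence
on the Choquet integral of `z - q`. -/
def cellGame [DecidableEq N] (v : (N → Fin (k + 1)) → ℝ) (q : N → Fin (k + 1))
    (A : Finset N) : ℝ :=
  v (fun i => if i ∈ A then level k ((q i : ℕ) + 1) else q i) - v q

/-- The Choquet integral `C_v(z) = v(q) + C_{μ_q}(z - q)`, `q = ⌊z⌋`, with respect to `v`. It is
meaningful for `z ∈ [0,k]^N` only. -/
def choquetExt [Fintype N] [DecidableEq N] (v : (N → Fin (k + 1)) → ℝ) (z : N → ℝ) : ℝ :=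
  v (gridFloor k z) +
    choquetIntegral (cellGame v (gridFloor k z)) (fun i => z i - ((gridFloor k z i : ℕ) : ℝ))

end Choquet

section Distributions

variable {N : Type*} [Fintype N]

/-- The closed box `[0,k]^N`. -/
def closedBox (N : Type*) (k : ℕ) : Set (N → ℝ) := Set.univ.pi fun _ => Set.Icc (0 : ℝ) k

/-- The open box `(0,k)^N`. -/
def openBox (N : Type*) [Fintype N] (k : ℕ) : Opens (N → ℝ) :=
  ⟨Set.univ.pi fun _ => Set.Ioo (0 : ℝ) k,
    isOpen_set_pi Set.finite_univ fun _ _ => isOpen_Ioo⟩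

/-- The distribution `g ↦ ∫ g(z) f(z) dz` on `Ω` defined by a locally integrable function `f`. -/
def toDistribution (Ω : Opens (N → ℝ)) (f : (N → ℝ) → ℝ) : 𝓓'(Ω, ℝ) :=
  TestFunction.integralAgainstBilinCLM (ContinuousLinearMap.mul ℝ ℝ) volume f

/-- The mixed partial derivative `∂^{|T|} u / ∂z_T` (one derivative with respect to each
coordinate in `T`) of a distribution `u`. The order of differentiation is immaterial. -/
def mixedPartial [DecidableEq N] {Ω : Opens (N → ℝ)} (T : Finset N) (u : 𝓓'(Ω, ℝ)) : 𝓓'(Ω, ℝ) :=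
  ∂^{fun j : Fin T.card => (Pi.single (T.equivFin.symm j : N) (1 : ℝ) : N → ℝ)} u

/-- The distribution `u` on `Ω` is the finite signed measure `D`: `u(g) = ∫ g dD` for every test
function `g` on `Ω`. -/
def IsRepresentedBy {Ω : Opens (N → ℝ)} (u : 𝓓'(Ω, ℝ)) (D : SignedMeasure (N → ℝ)) : Prop :=
  ∀ g : 𝓓(Ω, ℝ), u g = ∫ᵛ z, g z ∂<•D

/-- The ordinary (pointwise) partial derivative `∂f/∂z_i (z)`. -/
def partialDeriv [DecidableEq N] (i : N) (f : (N → ℝ) → ℝ) (z : N → ℝ) : ℝ :=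
  deriv (fun s => f (Function.update z i s)) (z i)

end Distributions

end KAry

end

/-!
On `[0, k]^N` the Choquet integral is the average `C_v(z) = ∫_0^1 v(⌊z + 1 - t⌋) dt` of `v` along
the diagonal. By inclusion-exclusion over the vertices of the unit cells, `v ∘ ⌊·⌋` is a finite
linear combination of indicator functions of orthants, so `C_v` is a finite linear combination of
convolutions of an orthant's indicator function with the uniform measure on a diagonal segment. One
derivative with respect to each coordinate in `T` turns the indicator function of an orthant into
Lebesgue measure on a face, which exhibits `∂^{|T|} C_v / ∂z_T` as an explicit signed measure. Its
mass on the open box factorizes over the coordinates for each `t`, and integrating over `t` gives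
the beta integrals `∫_0^1 t^a (1 - t)^b dt = a! b! / (a + b + 1)!` that are the coefficients of the
interaction index. Since `C_v` is Lipschitz, its ordinary partial derivatives exist almost
everywhere and represent the distributional ones.
-/

noncomputable section

namespace KAry

open Set Filter
open scoped Topology Pointwise

section UpdatePi

variable {ι : Type*} [Fintype ι] [DecidableEq ι] {X : ι → Type*} [∀ i, MeasurableSpace (X i)]

theorem measurePreserving_update_pi (μ : ∀ i, Measure (X i)) [∀ i, SigmaFinite (μ i)] (j : ι)
    (ν : Measure (X j)) [IsProbabilityMeasure ν] :
    MeasurePreserving (fun p : X j × (∀ i, X i) => Function.update p.2 j p.1)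
      ((μ j).prod (Measure.pi (Function.update μ j ν))) (Measure.pi μ) := by
  have : ∀ i, SigmaFinite (Function.update μ j ν i) :=
    (Function.forall_update_iff μ fun _ ρ => SigmaFinite ρ).2
      ⟨inferInstance, fun _ _ => inferInstance⟩
  have hmeas : Measurable fun p : X j × (∀ i, X i) => Function.update p.2 j p.1 :=
    measurable_update'.comp measurable_swap
  refine ⟨hmeas, (Measure.pi_eq fun s hs => ?_).symm⟩
  have hpre : (fun p : X j × (∀ i, X i) => Function.update p.2 j p.1) ⁻¹' univ.pi s =
      s j ×ˢ univ.pi (Function.update s j univ) := by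
    ext p
    simp only [mem_preimage, mem_univ_pi, mem_prod,
      Function.forall_update_iff p.2 fun i y => y ∈ s i,
      Function.forall_update_iff s fun i u => p.2 i ∈ u, mem_univ, true_and]
  rw [Measure.map_apply hmeas (.univ_pi hs), hpre, Measure.prod_prod, Measure.pi_pi,
    ← Finset.mul_prod_erase Finset.univ _ (Finset.mem_univ j),
    ← Finset.mul_prod_erase Finset.univ (fun i => μ i (s i)) (Finset.mem_univ j),
    Function.update_self, Function.update_self, measure_univ, one_mul]
  congr 1
  refine Finset.prod_congr rfl fun i hi => ?_
  rw [Function.update_of_ne (Finset.ne_of_mem_erase hi),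
    Function.update_of_ne (Finset.ne_of_mem_erase hi)]

theorem integral_pi_eq_integral_integral_update {E : Type*} [NormedAddCommGroup E]
    [NormedSpace ℝ E] (μ : ∀ i, Measure (X i)) [∀ i, SigmaFinite (μ i)] (j : ι)
    (ν : Measure (X j)) [IsProbabilityMeasure ν] {f : (∀ i, X i) → E}
    (hf : Integrable f (Measure.pi μ)) :
    ∫ z, f z ∂Measure.pi μ =
      ∫ z, ∫ s, f (Function.update z j s) ∂μ j ∂Measure.pi (Function.update μ j ν) := by
  have : ∀ i, SigmaFinite (Function.update μ j ν i) :=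
    (Function.forall_update_iff μ fun _ ρ => SigmaFinite ρ).2
      ⟨inferInstance, fun _ _ => inferInstance⟩
  have hupdate := measurePreserving_update_pi μ j ν
  rw [← hupdate.map_eq] at hf
  rw [← hupdate.map_eq, integral_map hupdate.aemeasurable hf.aestronglyMeasurable]
  exact integral_prod_symm _ (hf.comp_measurable hupdate.measurable)

end UpdatePi

theorem isFiniteMeasureOnCompacts_conv {G : Type*} [AddGroup G] [TopologicalSpace G]
    [IsTopologicalAddGroup G] [T2Space G] [MeasurableSpace G] [BorelSpace G] [MeasurableAdd₂ G]
    {μ ν : Measure G} [IsFiniteMeasureOnCompacts μ] [IsFiniteMeasureOnCompacts ν] [SFinite ν]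
    {S : Set G} (hS : IsCompact S) (hμS : μ Sᶜ = 0) :
    IsFiniteMeasureOnCompacts (μ ∗ ν) := by
  refine ⟨fun K hK => ?_⟩
  have hae : (fun p : G × G => p.1 + p.2) ⁻¹' K ≤ᵐ[μ.prod ν] S ×ˢ (-S + K) := by
    have hfst : ∀ᵐ p ∂μ.prod ν, p.1 ∈ S := Measure.quasiMeasurePreserving_fst.ae hμS
    filter_upwards [hfst] with p hp hpK
    exact ⟨hp, -p.1, neg_mem_neg.2 hp, p.1 + p.2, hpK, neg_add_cancel_left _ _⟩
  rw [Measure.conv, Measure.map_apply measurable_add hK.measurableSet]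
  calc μ.prod ν ((fun p : G × G => p.1 + p.2) ⁻¹' K)
      ≤ μ.prod ν (S ×ˢ (-S + K)) := measure_mono_ae hae
    _ = μ S * ν (-S + K) := Measure.prod_prod _ _
    _ < ⊤ := ENNReal.mul_lt_top hS.measure_lt_top (hS.neg.add hK).measure_lt_top

section OrthantFace

variable {ι : Type*} [DecidableEq ι]

/-- The `i`-th factor of the product measure `orthantFace T`: the half-line `[0, ∞)`, or its
endpoint for `i ∈ T`. -/
def orthantFaceFactor (T : Finset ι) (i : ι) : Measure ℝ :=
  if i ∈ T then Measure.dirac 0 else volume.restrict (Ici 0)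

instance (T : Finset ι) (i : ι) : IsLocallyFiniteMeasure (orthantFaceFactor T i) := by
  unfold orthantFaceFactor; split_ifs <;> infer_instance

theorem orthantFaceFactor_insert (T : Finset ι) (j : ι) :
    orthantFaceFactor (insert j T) =
      Function.update (orthantFaceFactor T) j (Measure.dirac 0) := by
  ext1 i
  by_cases hij : i = j <;> simp [orthantFaceFactor, hij]

variable [Fintype ι]

/-- Lebesgue measure on the face `{z | z i = 0 for i ∈ T}` of the orthant `[0, ∞)^ι`. It is the
mixed distributional derivative with respect to the coordinates in `T` of the indicator function
of the orthant. -/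
def orthantFace (T : Finset ι) : Measure (ι → ℝ) := Measure.pi (orthantFaceFactor T)

instance (T : Finset ι) : SigmaFinite (orthantFace T) := by
  unfold orthantFace; infer_instance

instance (T : Finset ι) : IsLocallyFiniteMeasure (orthantFace T) := by
  unfold orthantFace; infer_instance

theorem orthantFace_empty : orthantFace (∅ : Finset ι) = volume.restrict (Ici 0) := by
  have hfactor : orthantFaceFactor (∅ : Finset ι) = fun _ => volume.restrict (Ici 0) := rfl
  simp only [orthantFace, hfactor, ← pi_univ_Ici, volume_pi, Measure.restrict_pi_pi,
    Pi.zero_apply]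

variable {E : Type*} [NormedAddCommGroup E] [NormedSpace ℝ E] [CompleteSpace E]

theorem integral_Ici_fderiv_update {g : (ι → ℝ) → E} (hg : ContDiff ℝ 1 g)
    (hgc : HasCompactSupport g) (j : ι) (z : ι → ℝ) (a : ℝ) :
    ∫ s in Ici a, fderiv ℝ g (Function.update z j s) (Pi.single j 1) =
      -g (Function.update z j a) := by
  have hderiv (s : ℝ) : fderiv ℝ g (Function.update z j s) (Pi.single j 1) =
      deriv (g ∘ Function.update z j) s :=
    ((hg.differentiable one_ne_zero _).hasFDerivAt.comp_hasDerivAt s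
      (hasDerivAt_update z j s)).deriv.symm
  simp only [integral_Ici_eq_integral_Ioi, hderiv]
  exact HasCompactSupport.integral_Ioi_deriv_eq (hg.comp (contDiff_update 1 z j))
    (hgc.comp_isClosedEmbedding (isClosedEmbedding_update z j)) a

theorem ae_orthantFace_apply_eq_zero {T : Finset ι} {j : ι} (hj : j ∈ T) :
    ∀ᵐ z ∂orthantFace T, z j = 0 := by
  have hdirac : ∀ᵐ s ∂orthantFaceFactor T j, s = 0 := by
    rw [orthantFaceFactor, if_pos hj, ae_dirac_eq]
    exact rfl
  exact Measure.tendsto_eval_ae_ae.eventually hdirac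

theorem integral_fderiv_orthantFace {g : (ι → ℝ) → E} (hg : ContDiff ℝ 1 g)
    (hgc : HasCompactSupport g) {T : Finset ι} {j : ι} (hj : j ∉ T) :
    ∫ z, fderiv ℝ g z (Pi.single j 1) ∂orthantFace T =
      -∫ z, g z ∂orthantFace (insert j T) := by
  have hint : Integrable (fun z => fderiv ℝ g z (Pi.single j 1)) (orthantFace T) :=
    ((hg.continuous_fderiv one_ne_zero).clm_apply continuous_const).integrable_of_hasCompactSupport
      (hgc.fderiv_apply ℝ _)
  calc ∫ z, fderiv ℝ g z (Pi.single j 1) ∂orthantFace T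
      = ∫ z, (∫ s in Ici (0 : ℝ), fderiv ℝ g (Function.update z j s) (Pi.single j 1))
          ∂orthantFace (insert j T) := by
        rw [orthantFace, integral_pi_eq_integral_integral_update _ j (Measure.dirac (0 : ℝ)) hint,
          orthantFace, orthantFaceFactor_insert, orthantFaceFactor, if_neg hj]
    _ = ∫ z, -g (Function.update z j 0) ∂orthantFace (insert j T) := by
        simp only [integral_Ici_fderiv_update hg hgc]
    _ = -∫ z, g z ∂orthantFace (insert j T) := by
        rw [← integral_neg]
        refine integral_congr_ae <|
          (ae_orthantFace_apply_eq_zero (Finset.mem_insert_self j T)).mono fun z hz => ?_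
        simp only [← hz, Function.update_eq_self]

end OrthantFace

section CornerMeasure

variable {ι : Type*}

/-- The uniform probability measure on the diagonal segment from `c` to `c + (1, …, 1)`. -/
def diagonalSegment (c : ι → ℝ) : Measure (ι → ℝ) :=
  (volume.restrict (Ioc (0 : ℝ) 1)).map fun t i => c i + t

instance (c : ι → ℝ) : IsFiniteMeasure (diagonalSegment c) := by
  unfold diagonalSegment; infer_instance

theorem diagonalSegment_compl_Icc [Finite ι] (c : ι → ℝ) :
    diagonalSegment c (Icc c (c + 1))ᶜ = 0 := by
  have hmaps : ∀ᵐ t ∂volume.restrict (Ioc (0 : ℝ) 1), (fun i => c i + t) ∈ Icc c (c + 1) := by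
    filter_upwards [ae_restrict_mem measurableSet_Ioc] with t ht
    exact ⟨fun i => by simpa using ht.1.le, fun i => by simpa using ht.2⟩
  rw [diagonalSegment, Measure.map_apply (by fun_prop) measurableSet_Icc.compl]
  exact hmaps

variable [Fintype ι] [DecidableEq ι]

/-- The convolution of `diagonalSegment c` and `orthantFace T`. It is the mixed distributional
derivative of `clippedMin c` with respect to the coordinates in `T`. -/
def cornerMeasure (T : Finset ι) (c : ι → ℝ) : Measure (ι → ℝ) :=
  diagonalSegment c ∗ orthantFace T

instance (T : Finset ι) (c : ι → ℝ) : IsFiniteMeasureOnCompacts (cornerMeasure T c) :=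
  isFiniteMeasureOnCompacts_conv isCompact_Icc (diagonalSegment_compl_Icc c)

variable {E : Type*} [NormedAddCommGroup E] [NormedSpace ℝ E]

theorem integral_cornerMeasure {T : Finset ι} {c : ι → ℝ} {f : (ι → ℝ) → E}
    (hf : Integrable f (cornerMeasure T c)) :
    ∫ z, f z ∂cornerMeasure T c =
      ∫ t in Ioc (0 : ℝ) 1, ∫ y, f ((fun i => c i + t) + y) ∂orthantFace T := by
  have hprod : AEStronglyMeasurable (fun p : (ι → ℝ) × (ι → ℝ) => f (p.1 + p.2))
      ((diagonalSegment c).prod (orthantFace T)) :=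
    hf.aestronglyMeasurable.comp_measurable measurable_add
  rw [cornerMeasure, integral_conv hf, diagonalSegment,
    integral_map (by fun_prop) hprod.integral_prod_right']

theorem integral_fderiv_cornerMeasure [CompleteSpace E] {g : (ι → ℝ) → E} (hg : ContDiff ℝ 1 g)
    (hgc : HasCompactSupport g) {T : Finset ι} {j : ι} (hj : j ∉ T) (c : ι → ℝ) :
    ∫ z, fderiv ℝ g z (Pi.single j 1) ∂cornerMeasure T c =
      -∫ z, g z ∂cornerMeasure (insert j T) c := by
  have hderiv : Integrable (fun z => fderiv ℝ g z (Pi.single j 1)) (cornerMeasure T c) :=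
    ((hg.continuous_fderiv one_ne_zero).clm_apply
      continuous_const).integrable_of_hasCompactSupport (hgc.fderiv_apply ℝ _)
  have hint : Integrable g (cornerMeasure (insert j T) c) :=
    hg.continuous.integrable_of_hasCompactSupport hgc
  rw [cornerMeasure, integral_conv hderiv, cornerMeasure, integral_conv hint, ← integral_neg]
  congr 1 with x
  simp only [← fderiv_comp_add_left]
  exact integral_fderiv_orthantFace (hg.comp (contDiff_const.add contDiff_id))
    (hgc.comp_homeomorph (Homeomorph.addLeft x)) hj

end CornerMeasure

section ClippedMin

variable {ι : Type*}

theorem integrableOn_indicator_diagonal_le [Finite ι] (c z : ι → ℝ) :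
    IntegrableOn ({t | (fun i => c i + t) ≤ z}.indicator (1 : ℝ → ℝ)) (Ioc (0 : ℝ) 1) :=
  (integrable_const 1).indicator (measurableSet_le (by fun_prop) measurable_const)

variable [Fintype ι]

/-- `(min (1, min_i (z i - c i)))⁺`, the length of the set of all `t ∈ (0, 1]` such that `z` lies in
the orthant with vertex `c + (t, …, t)`. -/
def clippedMin (c z : ι → ℝ) : ℝ := max (Finset.univ.fold min 1 fun i => z i - c i) 0

theorem clippedMin_nonneg (c z : ι → ℝ) : 0 ≤ clippedMin c z := le_max_right _ _

theorem lipschitzWith_clippedMin (c : ι → ℝ) : LipschitzWith 1 (clippedMin c) := by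
  refine LipschitzWith.of_le_add fun z w => ?_
  have hmin : (Finset.univ.fold min 1 fun i => z i - c i) - dist z w ≤
      Finset.univ.fold min 1 fun i => w i - c i := by
    obtain ⟨hle_one, hle⟩ :=
      Finset.le_fold_min (Finset.univ.fold min 1 fun i => z i - c i) |>.1 le_rfl
    refine (Finset.le_fold_min _).2 ⟨by linarith [dist_nonneg (x := z) (y := w)], fun i hi => ?_⟩
    have hdist := (le_abs_self _).trans (dist_le_pi_dist z w i)
    linarith [hle i hi]
  exact max_le ((sub_le_iff_le_add.1 hmin).trans (by gcongr; exact le_max_left _ _))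
    (add_nonneg (clippedMin_nonneg c w) dist_nonneg)

theorem ofReal_clippedMin (c z : ι → ℝ) :
    ENNReal.ofReal (clippedMin c z) =
      volume.restrict (Ioc (0 : ℝ) 1) {t | (fun i => c i + t) ≤ z} := by
  have hIoc : {t | (fun i => c i + t) ≤ z} ∩ Ioc (0 : ℝ) 1 =
      Ioc 0 (Finset.univ.fold min 1 fun i => z i - c i) := by
    ext t
    simp only [mem_inter_iff, mem_ofPred_eq, mem_Ioc, Pi.le_def, Finset.le_fold_min,
      Finset.mem_univ, true_implies, le_sub_iff_add_le']
    tauto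
  rw [Measure.restrict_apply' measurableSet_Ioc, hIoc, Real.volume_Ioc, sub_zero, clippedMin,
    ENNReal.ofReal_max, ENNReal.ofReal_zero, max_eq_left zero_le]

theorem setIntegral_indicator_diagonal_le (c z : ι → ℝ) :
    ∫ t in Ioc (0 : ℝ) 1, {t | (fun i => c i + t) ≤ z}.indicator (1 : ℝ → ℝ) t =
      clippedMin c z := by
  rw [integral_indicator_one (measurableSet_le (by fun_prop) measurable_const), Measure.real,
    ← ofReal_clippedMin, ENNReal.toReal_ofReal (clippedMin_nonneg c z)]

theorem cornerMeasure_empty [DecidableEq ι] (c : ι → ℝ) :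
    cornerMeasure ∅ c = volume.withDensity fun z => ENNReal.ofReal (clippedMin c z) := by
  have hle : MeasurableSet {p : ℝ × (ι → ℝ) | (fun i => c i + p.1) ≤ p.2} :=
    measurableSet_le (by fun_prop) measurable_snd
  ext s hs
  calc cornerMeasure ∅ c s
      = ∫⁻ t in Ioc (0 : ℝ) 1, orthantFace ∅ (((fun i => c i + t) + ·) ⁻¹' s) := by
        rw [cornerMeasure, Measure.conv, Measure.map_apply measurable_add hs,
          Measure.prod_apply (measurable_add hs), diagonalSegment,
          lintegral_map (measurable_measure_prodMk_left (measurable_add hs)) (by fun_prop)]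
        rfl
    _ = ∫⁻ t in Ioc (0 : ℝ) 1, volume.restrict s {z | (fun i => c i + t) ≤ z} := by
        refine lintegral_congr fun t => ?_
        have hshift : ((fun i => c i + t) + ·) ⁻¹' s ∩ Ici 0 =
            ((fun i => c i + t) + ·) ⁻¹' ({z | (fun i => c i + t) ≤ z} ∩ s) := by
          ext y
          simp [and_comm]
        rw [orthantFace_empty, Measure.restrict_apply (measurable_const_add _ hs), hshift,
          measure_preimage_add, Measure.restrict_apply' hs]
    _ = ∫⁻ z in s, volume.restrict (Ioc (0 : ℝ) 1) {t | (fun i => c i + t) ≤ z} := by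
        exact (Measure.prod_apply hle).symm.trans (Measure.prod_apply_symm hle)
    _ = volume.withDensity (fun z => ENNReal.ofReal (clippedMin c z)) s := by
        simp only [withDensity_apply _ hs, ofReal_clippedMin]

end ClippedMin

section CornerSum

variable {N : Type*} [DecidableEq N] {k : ℕ}

/-- The vertex of the cell `[x - 1, x]` whose coordinates are maximal exactly on `B`. -/
def corner (x : N → Fin (k + 1)) (B : Finset N) : N → ℝ :=
  fun i => if i ∈ B then (x i : ℝ) else x i - 1

variable [Fintype N]

/-- The alternating sum of `F` over the vertices of each cell `[x - 1, x]`, weighted by `v x`. If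
`F c` is the indicator function of the orthant with vertex `c`, this is inclusion-exclusion for the
function that equals `v x` on the cell `[x - 1, x)`. -/
def cornerSum {M : Type*} [AddCommMonoid M] [Module ℝ M] (v : (N → Fin (k + 1)) → ℝ)
    (F : (N → ℝ) → M) : M :=
  ∑ p : (N → Fin (k + 1)) × Finset N, (v p.1 * (-1) ^ p.2.card) • F (corner p.1 p.2)

theorem cornerSum_prod (v : (N → Fin (k + 1)) → ℝ) (f : N → ℝ → ℝ) :
    cornerSum v (fun c => ∏ i, f i (c i)) =
      ∑ x, v x * ∏ i, (f i (x i - 1) - f i (x i)) := by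
  simp only [cornerSum, Fintype.sum_prod_type, smul_eq_mul, mul_assoc, ← Finset.mul_sum]
  refine Finset.sum_congr rfl fun x _ => ?_
  rw [Finset.prod_sub, Finset.powerset_univ]
  congr 1
  refine Finset.sum_congr rfl fun B _ => ?_
  simp only [corner, apply_ite (f _), Finset.prod_ite, Finset.filter_univ_mem,
    Finset.filter_notMem_eq_sdiff]
  ring

theorem exists_lipschitzWith_cornerSum {α : Type*} [PseudoMetricSpace α]
    (v : (N → Fin (k + 1)) → ℝ) {F : (N → ℝ) → α → ℝ} {K : NNReal}
    (hF : ∀ c, LipschitzWith K (F c)) :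
    ∃ C, LipschitzWith C fun a => cornerSum v fun c => F c a := by
  refine ⟨∑ p : (N → Fin (k + 1)) × Finset N, ‖v p.1 * (-1) ^ p.2.card‖₊ * K,
    LipschitzWith.of_dist_le_mul fun a b => ?_⟩
  rw [NNReal.coe_sum, Finset.sum_mul]
  exact dist_sum_sum_le_of_le _ fun p _ =>
    ((lipschitzWith_smul (v p.1 * (-1) ^ p.2.card)).comp (hF _)).dist_le_mul a b

theorem integrable_cornerSum {α E : Type*} [MeasurableSpace α] {μ : Measure α}
    [NormedAddCommGroup E] [NormedSpace ℝ E] (v : (N → Fin (k + 1)) → ℝ) {F : (N → ℝ) → α → E}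
    (hF : ∀ c, Integrable (F c) μ) : Integrable (fun a => cornerSum v fun c => F c a) μ :=
  integrable_finsetSum _ fun _ _ => (hF _).smul _

theorem integral_cornerSum {α E : Type*} [MeasurableSpace α] {μ : Measure α}
    [NormedAddCommGroup E] [NormedSpace ℝ E] (v : (N → Fin (k + 1)) → ℝ) {F : (N → ℝ) → α → E}
    (hF : ∀ c, Integrable (F c) μ) :
    ∫ a, cornerSum v (fun c => F c a) ∂μ = cornerSum v fun c => ∫ a, F c a ∂μ := by
  simp only [cornerSum, ← integral_smul]
  exact integral_finsetSum _ fun p _ => (hF _).smul _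

end CornerSum

section ChoquetExt

variable {N : Type*} {k : ℕ}

theorem level_of_le {m : ℕ} (hm : m ≤ k) : (level k m : ℕ) = m := min_eq_left hm

theorem floor_add_one_sub {a t : ℝ} (ha : 0 ≤ a) (ht : t ∈ Ioc (0 : ℝ) 1) :
    ⌊a + 1 - t⌋₊ = if t ≤ a - ⌊a⌋₊ then ⌊a⌋₊ + 1 else ⌊a⌋₊ := by
  have hfloor := Nat.floor_le ha
  have hlt := Nat.lt_floor_add_one a
  split_ifs with h <;> rw [Nat.floor_eq_iff (by linarith [ht.2])] <;> push_cast <;>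
    constructor <;> linarith [ht.1, ht.2]

theorem ite_sub_ite_eq_ite_level_floor (x : Fin (k + 1)) {a t : ℝ} (ha : a ∈ Icc (0 : ℝ) k)
    (ht : t ∈ Ioc (0 : ℝ) 1) :
    (if (x : ℝ) - 1 + t ≤ a then (1 : ℝ) else 0) - (if (x : ℝ) + t ≤ a then 1 else 0) =
      if x = level k ⌊a + 1 - t⌋₊ then 1 else 0 := by
  have hnonneg : 0 ≤ a + 1 - t := by linarith [ha.1, ht.2]
  have hle : ⌊a + 1 - t⌋₊ ≤ k := by
    rw [← Nat.lt_add_one_iff, Nat.floor_lt hnonneg]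
    push_cast
    linarith [ha.2, ht.1]
  have hlower : (x : ℝ) - 1 + t ≤ a ↔ (x : ℕ) ≤ ⌊a + 1 - t⌋₊ := by
    rw [Nat.le_floor_iff hnonneg]
    constructor <;> intro h <;> linarith
  have hupper : (x : ℝ) + t ≤ a ↔ (x : ℕ) + 1 ≤ ⌊a + 1 - t⌋₊ := by
    rw [Nat.le_floor_iff hnonneg]
    push_cast
    constructor <;> intro h <;> linarith
  have heq : x = level k ⌊a + 1 - t⌋₊ ↔ (x : ℕ) = ⌊a + 1 - t⌋₊ := by
    rw [Fin.ext_iff, level_of_le hle]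
  simp only [hlower, hupper, heq]
  split_ifs <;> first | omega | norm_num

theorem gridFloor_add_one_sub {z : N → ℝ} (hz : z ∈ closedBox N k) {t : ℝ}
    (ht : t ∈ Ioc (0 : ℝ) 1) :
    gridFloor k (fun i => z i + 1 - t) = fun i =>
      if t ≤ z i - (gridFloor k z i : ℕ) then
        level k (gridFloor k z i + 1)
      else gridFloor k z i := by
  ext1 i
  have hfloor : (level k ⌊z i⌋₊ : ℕ) = ⌊z i⌋₊ :=
    level_of_le (Nat.floor_le_of_le (hz i trivial).2)
  simp only [gridFloor, floor_add_one_sub (hz i trivial).1 ht, apply_ite (level k), hfloor]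

variable [Fintype N] [DecidableEq N]

theorem apply_gridFloor_eq_cornerSum (v : (N → Fin (k + 1)) → ℝ) {z : N → ℝ}
    (hz : z ∈ closedBox N k) {t : ℝ} (ht : t ∈ Ioc (0 : ℝ) 1) :
    v (gridFloor k fun i => z i + 1 - t) =
      cornerSum v fun c => {t | (fun i => c i + t) ≤ z}.indicator (1 : ℝ → ℝ) t := by
  have hprod (c : N → ℝ) : {t | (fun i => c i + t) ≤ z}.indicator (1 : ℝ → ℝ) t =
      ∏ i, if c i + t ≤ z i then 1 else 0 := by
    simp [Finset.prod_boole, indicator_apply, Pi.le_def]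
  have hcell (x : N → Fin (k + 1)) :
      (∏ i, if x i = level k ⌊z i + 1 - t⌋₊ then (1 : ℝ) else 0) =
        if x = gridFloor k (fun i => z i + 1 - t) then 1 else 0 := by
    simp [Finset.prod_boole, funext_iff, gridFloor]
  simp only [hprod]
  rw [cornerSum_prod v fun i a => if a + t ≤ z i then (1 : ℝ) else 0]
  simp [ite_sub_ite_eq_ite_level_floor _ (hz _ trivial) ht, hcell]

theorem cellGame_gridFloor (v : (N → Fin (k + 1)) → ℝ) {z : N → ℝ} (hz : z ∈ closedBox N k)
    {t : ℝ} (ht : t ∈ Ioc (0 : ℝ) 1) :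
    cellGame v (gridFloor k z) (Finset.univ.filter fun i => t ≤ z i - (gridFloor k z i : ℕ)) =
      v (gridFloor k fun i => z i + 1 - t) - v (gridFloor k z) := by
  simp only [cellGame, Finset.mem_filter_univ, gridFloor_add_one_sub hz ht]

theorem cellGame_gridFloor_of_one_lt (v : (N → Fin (k + 1)) → ℝ) {z : N → ℝ}
    (hz : z ∈ closedBox N k) {t : ℝ} (ht : 1 < t) :
    cellGame v (gridFloor k z) (Finset.univ.filter fun i => t ≤ z i - (gridFloor k z i : ℕ)) =
      0 := by
  have hlt (i : N) : z i - (gridFloor k z i : ℕ) < t := by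
    rw [gridFloor, level_of_le (Nat.floor_le_of_le (hz i trivial).2)]
    linarith [Nat.lt_floor_add_one (z i)]
  simp [cellGame, (hlt _).not_ge]

theorem choquetExt_eq_cornerSum (v : (N → Fin (k + 1)) → ℝ) {z : N → ℝ}
    (hz : z ∈ closedBox N k) :
    choquetExt v z = cornerSum v fun c => clippedMin c z := by
  have hcell : EqOn
      (fun t => cellGame v (gridFloor k z)
        (Finset.univ.filter fun i => t ≤ z i - (gridFloor k z i : ℕ)))
      (fun t => (cornerSum v fun c => {t | (fun i => c i + t) ≤ z}.indicator (1 : ℝ → ℝ) t) -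
        v (gridFloor k z)) (Ioc 0 1) := fun t ht => by
    simp only [cellGame_gridFloor v hz ht, apply_gridFloor_eq_cornerSum v hz ht]
  rw [choquetExt, choquetIntegral, setIntegral_eq_of_subset_of_forall_sdiff_eq_zero
      measurableSet_Ioi Ioc_subset_Ioi_self fun t ht =>
        cellGame_gridFloor_of_one_lt v hz (not_le.1 fun h => ht.2 ⟨ht.1, h⟩),
    setIntegral_congr_fun measurableSet_Ioc hcell, integral_sub, integral_cornerSum]
  · simp [setIntegral_indicator_diagonal_le]
  · exact fun c => integrableOn_indicator_diagonal_le c z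
  · exact integrable_cornerSum v fun c => integrableOn_indicator_diagonal_le c z
  · exact integrable_const _

end ChoquetExt

section Cutoff

variable {E : Type*} [NormedAddCommGroup E] [NormedSpace ℝ E] {Ω : Opens E}

theorem testFunction_apply_eq_zero_of_notMem (g : 𝓓(Ω, ℝ)) {z : E} (hz : z ∉ Ω) : g z = 0 :=
  image_eq_zero_of_notMem_tsupport fun h => hz (g.tsupport_subset h)

theorem setIntegral_testFunction [MeasurableSpace E] (g : 𝓓(Ω, ℝ)) (μ : Measure E) :
    ∫ z in Ω, g z ∂μ = ∫ z, g z ∂μ :=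
  setIntegral_eq_integral_of_forall_compl_eq_zero fun _ hz =>
    testFunction_apply_eq_zero_of_notMem g hz

variable [FiniteDimensional ℝ E]

theorem exists_testFunction_eqOn_one {K : Set E} (hK : IsCompact K) (hKΩ : K ⊆ Ω) :
    ∃ g : 𝓓(Ω, ℝ), EqOn g 1 K ∧ ∀ z, g z ∈ Icc (0 : ℝ) 1 := by
  obtain ⟨L, hL, hKL, hLΩ⟩ := exists_compact_between hK Ω.isOpen hKΩ
  obtain ⟨f, hf, hrange, hsupp, hone⟩ := exists_contMDiff_support_eq_eq_one_iff
    (n := ⊤) (modelWithCornersSelf ℝ E) isOpen_interior hK.isClosed hKL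
  have htsupp : tsupport f ⊆ L := by
    rw [tsupport, hsupp]
    exact closure_minimal interior_subset hL.isClosed
  exact ⟨⟨f, hf.contDiff, hL.of_isClosed_subset (isClosed_tsupport f) htsupp, htsupp.trans hLΩ⟩,
    fun z hz => (hone z).1 hz, fun z => hrange (mem_range_self z)⟩

/-- A sequence of test functions on `Ω`, bounded by `1`, that converges pointwise to the indicator
function of `Ω`. Evaluating a distribution given by a measure along it yields the total mass. -/
structure IsCutoff (g : ℕ → 𝓓(Ω, ℝ)) : Prop where
  norm_le_one (n : ℕ) (z : E) : ‖g n z‖ ≤ 1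
  tendsto (z : E) : Tendsto (fun n => g n z) atTop (𝓝 ((Ω : Set E).indicator 1 z))

theorem exists_isCutoff (Ω : Opens E) : ∃ g : ℕ → 𝓓(Ω, ℝ), IsCutoff g := by
  obtain ⟨F, hclosed, hFΩ, hF, hmono⟩ := Ω.isOpen.exists_iUnion_isClosed
  have hcompact (n : ℕ) : IsCompact (F n ∩ Metric.closedBall 0 n) :=
    (isCompact_closedBall 0 (n : ℝ)).inter_left (hclosed n)
  choose g hone hrange using fun n =>
    exists_testFunction_eqOn_one (hcompact n) (inter_subset_left.trans (hFΩ n))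
  refine ⟨g, fun n z => ?_, fun z => ?_⟩
  · rw [Real.norm_of_nonneg (hrange n z).1]
    exact (hrange n z).2
  · by_cases hz : z ∈ (Ω : Set E)
    · obtain ⟨m, hm⟩ := mem_iUnion.1 (hF ▸ hz)
      rw [indicator_of_mem hz]
      refine tendsto_const_nhds.congr' ?_
      filter_upwards [eventually_ge_atTop m, eventually_ge_atTop ⌈‖z‖⌉₊] with n hmn hzn
      exact (hone n ⟨hmono hmn hm, mem_closedBall_zero_iff.2 (Nat.ceil_le.1 hzn)⟩).symm
    · rw [indicator_of_notMem hz]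
      exact tendsto_const_nhds.congr fun n => (testFunction_apply_eq_zero_of_notMem (g n) hz).symm

end Cutoff

section Distribution

variable {N : Type*} [Fintype N] {Ω : Opens (N → ℝ)}

theorem isFiniteMeasure_variation {α : Type*} [MeasurableSpace α] (D : SignedMeasure α) :
    IsFiniteMeasure D.variation := by
  rw [← SignedMeasure.totalVariation_eq_variation, SignedMeasure.totalVariation]
  infer_instance

theorem IsRepresentedBy.tendsto_apply_of_isCutoff {u : 𝓓'(Ω, ℝ)} {D : SignedMeasure (N → ℝ)}
    (hD : IsRepresentedBy u D) {g : ℕ → 𝓓(Ω, ℝ)} (hg : IsCutoff g) :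
    Tendsto (fun n => u (g n)) atTop (𝓝 (D Ω)) := by
  have := isFiniteMeasure_variation D
  have hlim : Tendsto (fun n => ∫ᵛ z, g n z ∂<•D) atTop
      (𝓝 (∫ᵛ z, (Ω : Set (N → ℝ)).indicator (fun _ => (1 : ℝ)) z ∂<•D)) :=
    VectorMeasure.tendsto_integral_of_dominated_convergence (fun _ => 1)
      (fun n => (g n).continuous.aestronglyMeasurable) (integrable_const _)
      (fun n => .of_forall (hg.norm_le_one n)) (.of_forall hg.tendsto)
  rw [VectorMeasure.integral_indicator_const (1 : ℝ) Ω.isOpen.measurableSet] at hlim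
  simpa [hD _] using hlim

theorem IsRepresentedBy.apply_eq {u : 𝓓'(Ω, ℝ)} {D D' : SignedMeasure (N → ℝ)}
    (hD : IsRepresentedBy u D) (hD' : IsRepresentedBy u D') : D Ω = D' Ω := by
  obtain ⟨g, hg⟩ := exists_isCutoff Ω
  exact tendsto_nhds_unique (hD.tendsto_apply_of_isCutoff hg) (hD'.tendsto_apply_of_isCutoff hg)

theorem setIntegral_testFunction_mul (g : 𝓓(Ω, ℝ)) (f : (N → ℝ) → ℝ) :
    ∫ z in Ω, g z * f z = ∫ z, g z * f z :=
  setIntegral_eq_integral_of_forall_compl_eq_zero fun z hz => by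
    rw [testFunction_apply_eq_zero_of_notMem g hz, zero_mul]

theorem toDistribution_apply_of_eqOn {f h : (N → ℝ) → ℝ} (hf : ContinuousOn f Ω)
    (hfh : EqOn f h Ω) (g : 𝓓(Ω, ℝ)) : toDistribution Ω f g = ∫ z, g z * h z := by
  calc toDistribution Ω f g
      = ∫ z, g z * f z := TestFunction.integralAgainstBilinCLM_eq_integral
        (hf.locallyIntegrableOn Ω.isOpen.measurableSet)
    _ = ∫ z in Ω, g z * f z := (setIntegral_testFunction_mul g f).symm
    _ = ∫ z in Ω, g z * h z := setIntegral_congr_fun Ω.isOpen.measurableSet fun z hz => by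
        simp only [hfh hz]
    _ = ∫ z, g z * h z := setIntegral_testFunction_mul g h

theorem lineDerivOp_apply (g : 𝓓(Ω, ℝ)) (w z : N → ℝ) :
    (∂_{w} g : 𝓓(Ω, ℝ)) z = fderiv ℝ g z w := by
  rw [← ((g.contDiff.differentiable (by simp)) z).lineDeriv_eq_fderiv]
  exact TestFunction.lineDerivCLM_apply_of_le (𝕜 := ℝ) (k := ⊤) (n := ⊤) (by simp)

end Distribution

theorem hasDerivAt_comp_update {ι F : Type*} [Finite ι] [DecidableEq ι] [NormedAddCommGroup F]
    [NormedSpace ℝ F] {f : (ι → ℝ) → F} {f' : (ι → ℝ) →L[ℝ] F} {z : ι → ℝ}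
    (hf : HasFDerivAt f f' z) (i : ι) :
    HasDerivAt (fun s => f (Function.update z i s)) (f' (Pi.single i 1)) (z i) := by
  cases nonempty_fintype ι
  rw [← Function.update_eq_self i z] at hf
  exact hf.comp_hasDerivAt (z i) (hasDerivAt_update z i (z i))

theorem ae_restrict_differentiableAt {E : Type*} [NormedAddCommGroup E] [NormedSpace ℝ E]
    [FiniteDimensional ℝ E] [MeasurableSpace E] [BorelSpace E] {μ : Measure E}
    [μ.IsAddHaarMeasure] {C : NNReal} {f : E → ℝ} {s : Set E} (hs : IsOpen s)
    (hf : LipschitzOnWith C f s) : ∀ᵐ z ∂μ.restrict s, DifferentiableAt ℝ f z := by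
  rw [ae_restrict_iff' hs.measurableSet]
  filter_upwards [hf.ae_differentiableWithinAt_of_mem (μ := μ)] with z hz hzs
  exact (hz hzs).differentiableAt (hs.mem_nhds hzs)

section PartialDerivative

variable {N : Type*} [Fintype N] [DecidableEq N] {Ω : Opens (N → ℝ)} {C : NNReal}
  {f : (N → ℝ) → ℝ}

theorem partialDeriv_ae_eq_fderiv (hf : LipschitzOnWith C f Ω) (i : N) :
    partialDeriv i f =ᵐ[volume.restrict Ω] fun z => fderiv ℝ f z (Pi.single i 1) :=
  (ae_restrict_differentiableAt Ω.isOpen hf).mono fun _ hz =>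
    (hasDerivAt_comp_update hz.hasFDerivAt i).deriv

theorem integrableOn_partialDeriv (hf : LipschitzOnWith C f Ω) (hΩ : volume (Ω : Set (N → ℝ)) ≠ ⊤)
    (i : N) : IntegrableOn (partialDeriv i f) Ω := by
  refine Integrable.congr ?_ (partialDeriv_ae_eq_fderiv hf i).symm
  refine Measure.integrableOn_of_bounded (M := C * ‖(Pi.single i 1 : N → ℝ)‖) hΩ
    (measurable_fderiv_apply_const ℝ f _).aestronglyMeasurable ?_
  filter_upwards [ae_restrict_mem Ω.isOpen.measurableSet] with z hz
  exact (fderiv ℝ f z).le_of_opNorm_le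
    (norm_fderiv_le_of_lipschitzOn ℝ (Ω.isOpen.mem_nhds hz) hf) _

theorem mixedPartial_singleton_apply (i : N) (u : 𝓓'(Ω, ℝ)) (g : 𝓓(Ω, ℝ)) :
    mixedPartial {i} u g = -u (∂_{(Pi.single i 1 : N → ℝ)} g) := by
  have hone : mixedPartial {i} u = ∂_{(Pi.single i 1 : N → ℝ)} u := by
    refine (LineDeriv.iteratedLineDerivOp_one _ u).trans ?_
    rw [Finset.mem_singleton.1 (Subtype.prop _)]
  rw [hone, Distribution.lineDerivOp_apply_apply, map_neg]

theorem mixedPartial_singleton_toDistribution_apply (hf : LipschitzOnWith C f Ω) (i : N)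
    (g : 𝓓(Ω, ℝ)) :
    mixedPartial {i} (toDistribution Ω f) g = ∫ z in Ω, g z * partialDeriv i f z := by
  obtain ⟨h, hh, hfh⟩ := hf.extend_real
  obtain ⟨C', hg⟩ := (g.contDiff.of_le (m := 1) (by simp)).lipschitzWith_of_hasCompactSupport
    g.hasCompactSupport one_ne_zero
  have hderiv :
      partialDeriv i f =ᵐ[volume.restrict Ω] fun z => lineDeriv ℝ h z (Pi.single i 1) := by
    filter_upwards [partialDeriv_ae_eq_fderiv hf i, ae_restrict_differentiableAt Ω.isOpen hf,
      ae_restrict_mem Ω.isOpen.measurableSet] with z hz hdiff hzΩ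
    have heq : f =ᶠ[𝓝 z] h := hfh.eventuallyEq_of_mem (Ω.isOpen.mem_nhds hzΩ)
    rw [hz, ← hdiff.lineDeriv_eq_fderiv, heq.lineDeriv_eq]
  calc mixedPartial {i} (toDistribution Ω f) g
      = -∫ z, fderiv ℝ g z (Pi.single i 1) * h z := by
        rw [mixedPartial_singleton_apply, toDistribution_apply_of_eqOn hf.continuousOn hfh]
        simp only [lineDerivOp_apply]
    _ = ∫ z, lineDeriv ℝ g z (-Pi.single i 1) * h z := by
        simp only [(g.contDiff.differentiable (by simp) _).lineDeriv_eq_fderiv, map_neg, neg_mul,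
          integral_neg]
    _ = ∫ z, lineDeriv ℝ h z (Pi.single i 1) * g z :=
        (hh.integral_lineDeriv_mul_eq hg g.hasCompactSupport _).symm
    _ = ∫ z in Ω, g z * lineDeriv ℝ h z (Pi.single i 1) := by
        simp only [mul_comm _ (g _), setIntegral_testFunction_mul]
    _ = ∫ z in Ω, g z * partialDeriv i f z :=
        integral_congr_ae <| hderiv.mono fun z hz => by simp only [hz]

theorem setIntegral_partialDeriv_of_isRepresentedBy (hf : LipschitzOnWith C f Ω)
    (hΩ : volume (Ω : Set (N → ℝ)) ≠ ⊤) {i : N} {D : SignedMeasure (N → ℝ)}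
    (hD : IsRepresentedBy (mixedPartial {i} (toDistribution Ω f)) D) :
    ∫ z in Ω, partialDeriv i f z = D Ω := by
  obtain ⟨g, hg⟩ := exists_isCutoff Ω
  have hint := integrableOn_partialDeriv hf hΩ i
  refine tendsto_nhds_unique ?_ (hD.tendsto_apply_of_isCutoff hg)
  simp only [mixedPartial_singleton_toDistribution_apply hf]
  refine tendsto_integral_of_dominated_convergence (fun z => ‖partialDeriv i f z‖)
    (fun n => (g n).continuous.aestronglyMeasurable.mul hint.aestronglyMeasurable) hint.norm
    (fun n => .of_forall fun z => ?_) ?_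
  · rw [norm_mul]
    exact mul_le_of_le_one_left (norm_nonneg _) (hg.norm_le_one n z)
  · filter_upwards [ae_restrict_mem Ω.isOpen.measurableSet] with z hz
    simpa [indicator_of_mem hz] using (hg.tendsto z).mul_const (partialDeriv i f z)

end PartialDerivative

section MixedPartial

variable {N : Type*} [Fintype N] {Ω : Opens (N → ℝ)}

theorem integrable_testFunction (g : 𝓓(Ω, ℝ)) (μ : Measure (N → ℝ)) [IsFiniteMeasureOnCompacts μ] :
    Integrable g μ :=
  g.continuous.integrable_of_hasCompactSupport g.hasCompactSupport

variable [DecidableEq N]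

theorem iteratedLineDerivOp_single_apply {u : 𝓓'(Ω, ℝ)} {Φ : Finset N → 𝓓(Ω, ℝ) → ℝ}
    (hu : ∀ g, u g = Φ ∅ g)
    (hΦ : ∀ T, ∀ j ∉ T, ∀ g, Φ T (∂_{(Pi.single j 1 : N → ℝ)} g) = -Φ (insert j T) g)
    {n : ℕ} {e : Fin n → N} (he : Function.Injective e) (g : 𝓓(Ω, ℝ)) :
    (∂^{fun j => (Pi.single (e j) (1 : ℝ) : N → ℝ)} u : 𝓓'(Ω, ℝ)) g =
      Φ (Finset.univ.image e) g := by
  induction n generalizing g with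
  | zero => simpa using hu g
  | succ n ih =>
    have htail : e 0 ∉ Finset.univ.image (Fin.tail e) := by
      simpa [Fin.tail] using fun j => (he.ne (Fin.succ_ne_zero j))
    have himage : Finset.univ.image e = insert (e 0) (Finset.univ.image (Fin.tail e)) := by
      ext i
      simp [Fin.exists_fin_succ, Fin.tail, eq_comm]
    rw [LineDeriv.iteratedLineDerivOp_succ_left, Distribution.lineDerivOp_apply_apply, map_neg,
      himage, ← neg_eq_iff_eq_neg.2 (hΦ _ _ htail g)]
    exact congrArg Neg.neg (ih (he.comp (Fin.succ_injective n)) _)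

theorem mixedPartial_apply {u : 𝓓'(Ω, ℝ)} {Φ : Finset N → 𝓓(Ω, ℝ) → ℝ}
    (hu : ∀ g, u g = Φ ∅ g)
    (hΦ : ∀ T, ∀ j ∉ T, ∀ g, Φ T (∂_{(Pi.single j 1 : N → ℝ)} g) = -Φ (insert j T) g)
    (T : Finset N) (g : 𝓓(Ω, ℝ)) : mixedPartial T u g = Φ T g := by
  have himage : Finset.univ.image (fun j : Fin T.card => (T.equivFin.symm j : N)) = T := by
    rw [← Function.comp_def, ← Finset.image_image, Finset.image_univ_equiv,
      Finset.univ_eq_attach, Finset.attach_image_val]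
  conv_rhs => rw [← himage]
  exact iteratedLineDerivOp_single_apply hu hΦ
    (Subtype.val_injective.comp T.equivFin.symm.injective) g

theorem integral_lineDerivOp_cornerMeasure (g : 𝓓(Ω, ℝ)) {T : Finset N} {j : N} (hj : j ∉ T)
    (c : N → ℝ) :
    ∫ z, (∂_{(Pi.single j 1 : N → ℝ)} g : 𝓓(Ω, ℝ)) z ∂cornerMeasure T c =
      -∫ z, g z ∂cornerMeasure (insert j T) c := by
  simp only [lineDerivOp_apply]
  exact integral_fderiv_cornerMeasure (g.contDiff.of_le (by simp)) g.hasCompactSupport hj c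

end MixedPartial

section Box

variable {N : Type*} {k : ℕ}

theorem isCompact_closedBox : IsCompact (closedBox N k) :=
  isCompact_univ_pi fun _ => isCompact_Icc

variable [Fintype N]

theorem openBox_subset_closedBox : (openBox N k : Set (N → ℝ)) ⊆ closedBox N k :=
  pi_mono fun _ _ => Ioo_subset_Icc_self

theorem openBox_ae_eq_closedBox : (openBox N k : Set (N → ℝ)) =ᵐ[volume] closedBox N k :=
  (Measure.univ_pi_Ioo_ae_eq_Icc (f := 0) (g := fun _ => (k : ℝ))).trans (by
    rw [closedBox, ← pi_univ_Icc]; rfl)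

theorem measure_openBox_lt_top (μ : Measure (N → ℝ)) [IsFiniteMeasureOnCompacts μ] :
    μ (openBox N k) < ⊤ :=
  (measure_mono openBox_subset_closedBox).trans_lt isCompact_closedBox.measure_lt_top

instance (μ : Measure (N → ℝ)) [IsFiniteMeasureOnCompacts μ] :
    IsFiniteMeasure (μ.restrict (openBox N k)) :=
  isFiniteMeasure_restrict.2 (measure_openBox_lt_top μ).ne

theorem integrable_indicator_openBox (μ : Measure (N → ℝ)) [IsFiniteMeasureOnCompacts μ] :
    Integrable ((openBox N k : Set (N → ℝ)).indicator (1 : (N → ℝ) → ℝ)) μ :=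
  (integrable_indicator_iff (openBox N k).isOpen.measurableSet).2 (integrable_const 1)

variable [DecidableEq N]

theorem exists_lipschitzOnWith_choquetExt (v : (N → Fin (k + 1)) → ℝ) :
    ∃ C, LipschitzOnWith C (choquetExt v) (closedBox N k) := by
  obtain ⟨C, hC⟩ := exists_lipschitzWith_cornerSum v lipschitzWith_clippedMin
  refine ⟨C, fun z hz w hw => ?_⟩
  rw [choquetExt_eq_cornerSum v hz, choquetExt_eq_cornerSum v hw]
  exact hC z w

theorem integrableOn_choquetExt (v : (N → Fin (k + 1)) → ℝ) :
    IntegrableOn (choquetExt v) (closedBox N k) := by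
  obtain ⟨C, hC⟩ := exists_lipschitzOnWith_choquetExt v
  exact hC.continuousOn.integrableOn_compact isCompact_closedBox

theorem toDistribution_choquetExt_apply (v : (N → Fin (k + 1)) → ℝ) (g : 𝓓(openBox N k, ℝ)) :
    toDistribution (openBox N k) (choquetExt v) g =
      cornerSum v fun c => ∫ z, g z ∂cornerMeasure ∅ c := by
  obtain ⟨C, hC⟩ := exists_lipschitzOnWith_choquetExt v
  have hint (c : N → ℝ) : Integrable fun z => g z * clippedMin c z :=
    (g.continuous.mul (lipschitzWith_clippedMin c).continuous).integrable_of_hasCompactSupport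
      g.hasCompactSupport.mul_right
  have hdensity (c : N → ℝ) :
      ∫ z, g z ∂cornerMeasure ∅ c = ∫ z, g z * clippedMin c z := by
    rw [cornerMeasure_empty, integral_withDensity_eq_integral_toReal_smul
      (lipschitzWith_clippedMin c).continuous.measurable.ennreal_ofReal (by simp)]
    simp only [ENNReal.toReal_ofReal (clippedMin_nonneg c _), smul_eq_mul, mul_comm]
  rw [toDistribution_apply_of_eqOn (hC.continuousOn.mono openBox_subset_closedBox) fun z hz =>
    choquetExt_eq_cornerSum v (openBox_subset_closedBox hz)]
  simp only [hdensity, ← integral_cornerSum v hint]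
  simp only [cornerSum, smul_eq_mul, Finset.mul_sum, mul_left_comm (g _)]

theorem mixedPartial_choquetExt_apply (v : (N → Fin (k + 1)) → ℝ) (T : Finset N)
    (g : 𝓓(openBox N k, ℝ)) :
    mixedPartial T (toDistribution (openBox N k) (choquetExt v)) g =
      cornerSum v fun c => ∫ z, g z ∂cornerMeasure T c := by
  refine mixedPartial_apply (Φ := fun T g => cornerSum v fun c => ∫ z, g z ∂cornerMeasure T c)
    (toDistribution_choquetExt_apply v) (fun T j hj g => ?_) T g
  simp only [integral_lineDerivOp_cornerMeasure g hj, cornerSum, smul_neg, Finset.sum_neg_distrib]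

/-- The finite signed measure on the open box that represents the mixed distributional derivative
of the Choquet integral with respect to the coordinates in `T`. -/
def choquetDeriv (v : (N → Fin (k + 1)) → ℝ) (T : Finset N) : SignedMeasure (N → ℝ) :=
  cornerSum v fun c => ((cornerMeasure T c).restrict (openBox N k)).toSignedMeasure

theorem isRepresentedBy_choquetDeriv (v : (N → Fin (k + 1)) → ℝ) (T : Finset N) :
    IsRepresentedBy (mixedPartial T (toDistribution (openBox N k) (choquetExt v)))
      (choquetDeriv v T) := fun g => by
  rw [mixedPartial_choquetExt_apply, choquetDeriv, cornerSum, cornerSum,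
    VectorMeasure.integral_finsetSum_vectorMeasure]
  · simp only [VectorMeasure.integral_smul_vectorMeasure, VectorMeasure.integral_toSignedMeasure,
      setIntegral_testFunction, smul_eq_mul]
  · intro p _
    have := isFiniteMeasure_variation ((v p.1 * (-1 : ℝ) ^ p.2.card) •
      ((cornerMeasure T (corner p.1 p.2)).restrict (openBox N k)).toSignedMeasure)
    exact integrable_testFunction g _

theorem choquetDeriv_apply_openBox (v : (N → Fin (k + 1)) → ℝ) (T : Finset N) :
    choquetDeriv v T (openBox N k : Set (N → ℝ)) =
      cornerSum v fun c => (cornerMeasure T c).real (openBox N k) := by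
  simp [choquetDeriv, cornerSum, Measure.toSignedMeasure_apply_measurable
    (openBox N k).isOpen.measurableSet]

end Box

section FaceFactorMass

variable {ι : Type*} [DecidableEq ι] {T : Finset ι} {i : ι}

/-- The mass that the `i`-th factor of `orthantFace T`, translated by `a`, gives to `(0, k)`. -/
def faceFactorMass (k : ℕ) (T : Finset ι) (i : ι) (a : ℝ) : ℝ :=
  (orthantFaceFactor T i).real ((a + ·) ⁻¹' Ioo 0 k)

theorem faceFactorMass_of_mem (k : ℕ) (hi : i ∈ T) (a : ℝ) :
    faceFactorMass k T i a = if a ∈ Ioo (0 : ℝ) k then 1 else 0 := by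
  rw [faceFactorMass, orthantFaceFactor, if_pos hi, Measure.real,
    Measure.dirac_apply' _ (measurable_const_add a measurableSet_Ioo)]
  split_ifs with ha
  · rw [indicator_of_mem (by simpa using ha), Pi.one_apply, ENNReal.toReal_one]
  · rw [indicator_of_notMem (by simpa using ha), ENNReal.toReal_zero]

theorem faceFactorMass_of_notMem (k : ℕ) (hi : i ∉ T) (a : ℝ) :
    faceFactorMass k T i a = max (k - max a 0) 0 := by
  have hIoo : (a + ·) ⁻¹' Ioo (0 : ℝ) k ∩ Ioi 0 = Ioo (max (-a) 0) (k - a) := by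
    rw [preimage_const_add_Ioo, Ioo_inter_Ioi, zero_sub]
  rw [faceFactorMass, orthantFaceFactor, if_neg hi, Measure.restrict_congr_set Ioi_ae_eq_Ici.symm,
    measureReal_restrict_apply (measurable_const_add a measurableSet_Ioo), hIoo,
    Real.volume_real_Ioo, sub_sub, add_max, add_neg_cancel, add_zero, max_comm 0 a]

variable {k : ℕ}

theorem faceFactorMass_sub_of_mem (hk : k ≠ 0) (hi : i ∈ T) (x : Fin (k + 1)) {t : ℝ}
    (ht : t ∈ Ioo (0 : ℝ) 1) :
    faceFactorMass k T i (x - 1 + t) - faceFactorMass k T i (x + t) =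
      (if x = Fin.last k then 1 else 0) - if x = 0 then 1 else 0 := by
  have hx : (x : ℝ) ≤ k := mod_cast x.is_le
  have hlower : (x : ℝ) - 1 + t ∈ Ioo (0 : ℝ) k ↔ x ≠ 0 := by
    refine ⟨?_, fun h => ⟨?_, by linarith [ht.2]⟩⟩
    · rintro hmem rfl
      have := hmem.1
      simp only [Fin.val_zero, Nat.cast_zero] at this
      linarith [ht.2]
    · have : (1 : ℝ) ≤ x := mod_cast Nat.one_le_iff_ne_zero.2 (Fin.val_ne_zero_iff.2 h)
      linarith [ht.1]
  have hupper : (x : ℝ) + t ∈ Ioo (0 : ℝ) k ↔ x ≠ Fin.last k := by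
    refine ⟨?_, fun h => ⟨by positivity [ht.1], ?_⟩⟩
    · rintro hmem rfl
      have := hmem.2
      simp only [Fin.val_last] at this
      linarith [ht.1]
    · have : (x : ℝ) + 1 ≤ k := mod_cast Fin.val_lt_last h
      linarith [ht.2]
  simp only [faceFactorMass_of_mem k hi, hlower, hupper]
  split_ifs <;> simp_all

theorem faceFactorMass_sub_of_notMem (hk : k ≠ 0) (hi : i ∉ T) (x : Fin (k + 1)) {t : ℝ}
    (ht : t ∈ Ioo (0 : ℝ) 1) :
    faceFactorMass k T i (x - 1 + t) - faceFactorMass k T i (x + t) =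
      (if x = 0 then t else 1) * if x = Fin.last k then 1 - t else 1 := by
  have hx : (x : ℝ) ≤ k := mod_cast x.is_le
  have hlower : faceFactorMass k T i (x - 1 + t) = if x = 0 then (k : ℝ) else k - (x - 1 + t) := by
    rw [faceFactorMass_of_notMem k hi]
    split_ifs with h
    · have : (x : ℝ) = 0 := by simp [h]
      rw [max_eq_right (show (x : ℝ) - 1 + t ≤ 0 by linarith [ht.2]), sub_zero,
        max_eq_left k.cast_nonneg]
    · have : (1 : ℝ) ≤ x := mod_cast Nat.one_le_iff_ne_zero.2 (Fin.val_ne_zero_iff.2 h)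
      rw [max_eq_left (show (0 : ℝ) ≤ x - 1 + t by linarith [ht.1]),
        max_eq_left (by linarith [ht.2])]
  have hupper : faceFactorMass k T i (x + t) = if x = Fin.last k then 0 else k - (x + t) := by
    have : (0 : ℝ) ≤ x := x.val.cast_nonneg
    rw [faceFactorMass_of_notMem k hi, max_eq_left (show 0 ≤ (x : ℝ) + t by linarith [ht.1])]
    split_ifs with h
    · have : (x : ℝ) = k := by simp [h]
      exact max_eq_right (by linarith [ht.1])
    · have : (x : ℝ) + 1 ≤ k := mod_cast Fin.val_lt_last h
      exact max_eq_left (by linarith [ht.2])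
  have hlast : (0 : Fin (k + 1)) ≠ Fin.last k := fun h => hk (congrArg Fin.val h).symm
  rw [hlower, hupper]
  split_ifs with h0 h1 h1
  · exact absurd (h0.symm.trans h1) hlast
  · simp [h0]
  · rw [h1, Fin.val_last]
    ring
  · ring

end FaceFactorMass

section Boole

variable {N : Type*} [DecidableEq N] {k : ℕ}

theorem prod_boole_sub_boole (T : Finset N) (x : N → Fin (k + 1)) :
    ∏ i ∈ T, ((if x i = Fin.last k then (1 : ℝ) else 0) - if x i = 0 then 1 else 0) =
      ∑ A ∈ T.powerset, (-1) ^ (T.card - A.card) *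
        ∏ i ∈ T, if x i = (if i ∈ A then Fin.last k else 0) then 1 else 0 := by
  simp only [sub_eq_add_neg, Finset.prod_add, Finset.prod_neg]
  refine Finset.sum_congr rfl fun A hA => ?_
  have hAT := Finset.mem_powerset.1 hA
  rw [Finset.card_sdiff_of_subset hAT, mul_left_comm, ← Finset.prod_sdiff hAT,
    mul_comm (∏ i ∈ T \ A, _)]
  congr 2
  · exact Finset.prod_congr rfl fun i hi => by simp only [hi, if_true]
  · exact Finset.prod_congr rfl fun i hi => by simp only [(Finset.mem_sdiff.1 hi).2, if_false]

theorem compound_coe (T A : Finset N) (y : {i : N // i ∉ T} → Fin (k + 1)) (i : {i : N // i ∉ T}) :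
    compound T A y i = y i :=
  dif_neg i.2

variable [Fintype N]

theorem sum_filter_eq_sum_compound {M : Type*} [AddCommMonoid M] (T A : Finset N)
    (f : (N → Fin (k + 1)) → M) :
    ∑ x with ∀ i ∈ T, x i = (if i ∈ A then Fin.last k else 0), f x = ∑ y, f (compound T A y) := by
  have hcompound (x : N → Fin (k + 1))
      (hx : ∀ i ∈ T, x i = if i ∈ A then Fin.last k else 0) :
      compound T A (fun i => x i) = x := by
    ext1 i
    by_cases hi : i ∈ T
    · rw [compound, dif_pos hi, hx i hi]
    · rw [compound, dif_neg hi]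
  refine Finset.sum_nbij' (fun x i => x i) (compound T A) (fun _ _ => Finset.mem_univ _)
    (fun y _ => Finset.mem_filter_univ _ |>.2 fun i hi => dif_pos hi)
    (fun x hx => hcompound x (Finset.mem_filter_univ _ |>.1 hx))
    (fun y _ => funext (compound_coe T A y)) (fun x hx => ?_)
  rw [hcompound x (Finset.mem_filter_univ _ |>.1 hx)]

theorem sum_mul_prod_boole_sub_boole (T : Finset N) (f : (N → Fin (k + 1)) → ℝ) :
    ∑ x, f x * ∏ i ∈ T, ((if x i = Fin.last k then 1 else 0) - if x i = 0 then 1 else 0) =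
      ∑ y, ∑ A ∈ T.powerset, (-1) ^ (T.card - A.card) * f (compound T A y) := by
  simp only [prod_boole_sub_boole, Finset.mul_sum]
  rw [Finset.sum_comm, Finset.sum_comm (s := Finset.univ)]
  refine Finset.sum_congr rfl fun A _ => ?_
  rw [← Finset.mul_sum, ← sum_filter_eq_sum_compound T A f, Finset.sum_filter, Finset.mul_sum]
  refine Finset.sum_congr rfl fun x _ => ?_
  rw [Finset.prod_boole]
  split_ifs <;> ring

end Boole

section Mass

variable {N : Type*} [Fintype N] [DecidableEq N]

theorem integrableOn_integral_orthantFace {E : Type*} [NormedAddCommGroup E] [NormedSpace ℝ E]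
    {T : Finset N} {c : N → ℝ} {f : (N → ℝ) → E} (hf : Integrable f (cornerMeasure T c)) :
    IntegrableOn (fun t => ∫ y, f ((fun i => c i + t) + y) ∂orthantFace T) (Ioc (0 : ℝ) 1) := by
  have hsum : Integrable (fun p : (N → ℝ) × (N → ℝ) => f (p.1 + p.2))
      ((diagonalSegment c).prod (orthantFace T)) := hf.comp_measurable measurable_add
  exact hsum.integral_prod_left.comp_measurable (f := fun t i => c i + t) (by fun_prop)

theorem integral_indicator_openBox_orthantFace (k : ℕ) (T : Finset N) (c : N → ℝ) :
    ∫ y, (openBox N k : Set (N → ℝ)).indicator (1 : (N → ℝ) → ℝ) (c + y) ∂orthantFace T =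
      ∏ i, faceFactorMass k T i (c i) := by
  have hpre : (c + ·) ⁻¹' (openBox N k : Set (N → ℝ)) =
    univ.pi fun i => (c i + ·) ⁻¹' Ioo (0 : ℝ) k := rfl
  calc ∫ y, (openBox N k : Set (N → ℝ)).indicator (1 : (N → ℝ) → ℝ) (c + y) ∂orthantFace T
      = (orthantFace T).real ((c + ·) ⁻¹' (openBox N k : Set (N → ℝ))) :=
        integral_indicator_one (measurable_const_add c (openBox N k).isOpen.measurableSet)
    _ = ∏ i, faceFactorMass k T i (c i) := by
        simp only [hpre, orthantFace, Measure.real, Measure.pi_pi, ENNReal.toReal_prod,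
          faceFactorMass]

theorem integral_pow_mul_one_sub_pow (a b : ℕ) :
    ∫ t in Ioo (0 : ℝ) 1, t ^ a * (1 - t) ^ b = (a ! * b ! : ℕ) / (a + b + 1)! := by
  have hbeta : Complex.betaIntegral (a + 1) (b + 1) =
      ((∫ t in (0 : ℝ)..1, t ^ a * (1 - t) ^ b : ℝ) : ℂ) := by
    simp [Complex.betaIntegral, ← intervalIntegral.integral_ofReal]
  have hsum : (a + 1 + (b + 1) : ℂ) = (a + b + 1 : ℕ) + 1 := by push_cast; ring
  have hre (n : ℕ) : 0 < (n + 1 : ℂ).re := by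
    simp only [Complex.add_re, Complex.natCast_re, Complex.one_re]
    positivity
  rw [Complex.betaIntegral_eq_Gamma_mul_div _ _ (hre a) (hre b), hsum,
    Complex.Gamma_nat_eq_factorial, Complex.Gamma_nat_eq_factorial,
    Complex.Gamma_nat_eq_factorial] at hbeta
  rw [← integral_Ioc_eq_integral_Ioo, ← intervalIntegral.integral_of_le zero_le_one]
  refine Complex.ofReal_injective (hbeta.symm.trans ?_)
  push_cast
  rfl

theorem integral_pow_card_zero_mul_pow_kerCard {k : ℕ} (T : Finset N)
    (y : {i : N // i ∉ T} → Fin (k + 1)) :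
    ∫ t in Ioo (0 : ℝ) 1, t ^ (Finset.univ.filter fun i => y i = 0).card * (1 - t) ^ kerCard T y =
      ((Fintype.card N - suppCard T y - T.card)! * (kerCard T y)! : ℕ) /
        (Fintype.card N - suppCard T y + kerCard T y - T.card + 1)! := by
  have hcard : (Finset.univ.filter fun i => y i = 0).card + suppCard T y + T.card =
      Fintype.card N := by
    rw [suppCard, Finset.card_filter_add_card_filter_not, Finset.card_univ,
      Fintype.card_subtype_compl, Fintype.card_coe, Nat.sub_add_cancel T.card_le_univ]
  rw [integral_pow_mul_one_sub_pow]
  congr 4 <;> omega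

theorem integrableOn_prod_faceFactorMass (k : ℕ) (T : Finset N) (c : N → ℝ) :
    IntegrableOn (fun t => ∏ i, faceFactorMass k T i (c i + t)) (Ioo (0 : ℝ) 1) := by
  have hint := integrableOn_integral_orthantFace
    (integrable_indicator_openBox (k := k) (cornerMeasure T c))
  simp only [integral_indicator_openBox_orthantFace] at hint
  exact hint.mono_set Ioo_subset_Ioc_self

theorem measureReal_cornerMeasure_openBox (k : ℕ) (T : Finset N) (c : N → ℝ) :
    (cornerMeasure T c).real (openBox N k) =
      ∫ t in Ioo (0 : ℝ) 1, ∏ i, faceFactorMass k T i (c i + t) := by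
  rw [← integral_indicator_one (openBox N k).isOpen.measurableSet,
    integral_cornerMeasure (integrable_indicator_openBox _), integral_Ioc_eq_integral_Ioo]
  simp only [integral_indicator_openBox_orthantFace]

variable {k : ℕ}

theorem prod_faceFactorMass_sub (hk : k ≠ 0) (T : Finset N) (x : N → Fin (k + 1)) {t : ℝ}
    (ht : t ∈ Ioo (0 : ℝ) 1) :
    ∏ i, (faceFactorMass k T i (x i - 1 + t) - faceFactorMass k T i (x i + t)) =
      (t ^ (Finset.univ.filter fun i : {i // i ∉ T} => x i = 0).card *
          (1 - t) ^ kerCard T fun i => x i) *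
        ∏ i ∈ T, ((if x i = Fin.last k then 1 else 0) - if x i = 0 then 1 else 0) := by
  rw [← Fintype.prod_subtype_mul_prod_subtype (fun i => i ∈ T), mul_comm]
  congr 1
  · have hfactor (i : {i // i ∉ T}) := faceFactorMass_sub_of_notMem hk i.2 (x i) ht
    simp only [hfactor, Finset.prod_mul_distrib, Finset.prod_ite, Finset.prod_const, one_pow,
      mul_one, kerCard]
  · have hfactor (i : {i // i ∈ T}) := faceFactorMass_sub_of_mem hk i.2 (x i) ht
    simp only [hfactor]
    exact (Finset.prod_subtype T (fun _ => Iff.rfl) fun i =>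
      ((if x i = Fin.last k then 1 else 0) - if x i = 0 then 1 else 0 : ℝ)).symm

theorem cornerSum_measureReal_cornerMeasure (hk : k ≠ 0) (v : (N → Fin (k + 1)) → ℝ)
    (T : Finset N) :
    cornerSum v (fun c => (cornerMeasure T c).real (openBox N k)) = interaction v T := by
  have hcell {t : ℝ} (ht : t ∈ Ioo (0 : ℝ) 1) :
      cornerSum v (fun c => ∏ i, faceFactorMass k T i (c i + t)) =
        ∑ y, (t ^ (Finset.univ.filter fun i => y i = 0).card * (1 - t) ^ kerCard T y) *
          ∑ A ∈ T.powerset, (-1) ^ (T.card - A.card) * v (compound T A y) := by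
    rw [cornerSum_prod v fun i a => faceFactorMass k T i (a + t)]
    simp only [prod_faceFactorMass_sub hk T _ ht, ← mul_assoc (v _)]
    rw [sum_mul_prod_boole_sub_boole]
    simp only [compound_coe, Finset.mul_sum]
    exact Finset.sum_congr rfl fun y _ => Finset.sum_congr rfl fun A _ => by ring
  calc cornerSum v (fun c => (cornerMeasure T c).real (openBox N k))
      = ∫ t in Ioo (0 : ℝ) 1, cornerSum v fun c => ∏ i, faceFactorMass k T i (c i + t) := by
        simp only [measureReal_cornerMeasure_openBox,
          integral_cornerSum v fun c => integrableOn_prod_faceFactorMass k T c]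
    _ = ∫ t in Ioo (0 : ℝ) 1,
          ∑ y, (t ^ (Finset.univ.filter fun i => y i = 0).card * (1 - t) ^ kerCard T y) *
            ∑ A ∈ T.powerset, (-1) ^ (T.card - A.card) * v (compound T A y) :=
        setIntegral_congr_fun measurableSet_Ioo fun t ht => hcell ht
    _ = interaction v T := by
        rw [integral_finsetSum]
        · simp only [integral_mul_const, integral_pow_card_zero_mul_pow_kerCard, interaction]
        · intro y _
          exact (Continuous.integrableOn_Icc (by fun_prop)).mono_set Ioo_subset_Icc_self

end Mass

section IsCapacity

variable {N : Type*} {k : ℕ}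

theorem IsCapacity.ne_zero {v : (N → Fin (k + 1)) → ℝ} (hv : IsCapacity v) : k ≠ 0 := by
  rintro rfl
  exact zero_ne_one (hv.zero.symm.trans hv.top)

end IsCapacity

end KAry

end

open KAry in
theorem mainTheorem2_general {N : Type*} [Fintype N] [DecidableEq N] {k : ℕ}
    (hk : k ≠ 0) (v : (N → Fin (k + 1)) → ℝ) (T : Finset N) :
    IntegrableOn (choquetExt v) (closedBox N k) ∧
    (∃ D : SignedMeasure (N → ℝ),
      IsRepresentedBy
        (mixedPartial T (toDistribution (openBox N k) (choquetExt v))) D) ∧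
    (∀ D : SignedMeasure (N → ℝ),
      IsRepresentedBy
        (mixedPartial T (toDistribution (openBox N k) (choquetExt v))) D →
      D (openBox N k : Set (N → ℝ)) = interaction v T) ∧
    (∀ i : N, T = {i} →
      (∀ᵐ z ∂(volume.restrict (closedBox N k)),
        DifferentiableAt ℝ (fun s => choquetExt v (Function.update z i s)) (z i)) ∧
      IntegrableOn (partialDeriv i (choquetExt v)) (closedBox N k) ∧
      ∫ z in closedBox N k, partialDeriv i (choquetExt v) z =
        interaction v T) := by
  have hmass (S : Finset N) : choquetDeriv v S (openBox N k : Set (N → ℝ)) = interaction v S :=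
    (choquetDeriv_apply_openBox v S).trans (cornerSum_measureReal_cornerMeasure hk v S)
  refine ⟨integrableOn_choquetExt v, ⟨choquetDeriv v T, isRepresentedBy_choquetDeriv v T⟩,
    fun D hD => (hD.apply_eq (isRepresentedBy_choquetDeriv v T)).trans (hmass T), ?_⟩
  rintro i rfl
  obtain ⟨C, hC⟩ := exists_lipschitzOnWith_choquetExt v
  have hlip : LipschitzOnWith C (choquetExt v) (openBox N k) := hC.mono openBox_subset_closedBox
  have hfinite : volume (openBox N k : Set (N → ℝ)) ≠ ⊤ :=
    (measure_openBox_lt_top (N := N) volume).ne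
  rw [IntegrableOn, ← Measure.restrict_congr_set openBox_ae_eq_closedBox]
  refine ⟨?_, integrableOn_partialDeriv hlip hfinite i, ?_⟩
  · filter_upwards [ae_restrict_differentiableAt (openBox N k).isOpen hlip] with z hz
    exact (hasDerivAt_comp_update hz.hasFDerivAt i).differentiableAt
  · rw [setIntegral_partialDeriv_of_isRepresentedBy hlip hfinite
      (isRepresentedBy_choquetDeriv v {i}), hmass]

theorem mainTheorem2 {N : Type*} [Fintype N] [DecidableEq N] (k : ℕ)
    (v : (N → Fin (k + 1)) → ℝ) (hv : KAry.IsCapacity v) (T : Finset N) :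
    IntegrableOn (KAry.choquetExt v) (KAry.closedBox N k) ∧
    (∃ D : SignedMeasure (N → ℝ),
      KAry.IsRepresentedBy
        (KAry.mixedPartial T (KAry.toDistribution (KAry.openBox N k) (KAry.choquetExt v))) D) ∧
    (∀ D : SignedMeasure (N → ℝ),
      KAry.IsRepresentedBy
        (KAry.mixedPartial T (KAry.toDistribution (KAry.openBox N k) (KAry.choquetExt v))) D →
      D (KAry.openBox N k : Set (N → ℝ)) = KAry.interaction v T) ∧
    (∀ i : N, T = {i} →
      (∀ᵐ z ∂(volume.restrict (KAry.closedBox N k)),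
        DifferentiableAt ℝ (fun s => KAry.choquetExt v (Function.update z i s)) (z i)) ∧
      IntegrableOn (KAry.partialDeriv i (KAry.choquetExt v)) (KAry.closedBox N k) ∧
      ∫ z in KAry.closedBox N k, KAry.partialDeriv i (KAry.choquetExt v) z =
        KAry.interaction v T) :=
  mainTheorem2_general hv.ne_zero v T
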